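/- Jobs and spot instances arrive as two independent renewal processes: the job inter-arrival times $A_1,A_2,\dots$ are i.i.d. copies of $A\ge 0$, the spot inter-arrival times are i.i.d. copies of $S_\mu\ge 0$, and $0<\mathbb{E}[A],\mathbb{E}[S_\mu]<\infty$. Let $N_A(t)$ be the number of jobs that have arrived by time $t$. The queue starts empty. A job that finds $n$ jobs waiting joins the queue with probability $q_n\in[0,1]$, decided by a coin independent of everything else; otherwise it goes to an on-demand instance at once. A job that joins waits at most a maximal waiting time in $[0,\infty]$, which is an arbitrary random variable that may depend on the job and on the number of jobs it found; if no spot instance has served it before this time expires, it leaves the queue for an on-demand instance. A spot instance that arrives when jobs are waiting serves the first one in the queue (first come, first served); one that finds the queue empty is lost. (A job arriving at the same instant as a spot instance counts as having arrived before it.) A job served by a spot instance costs $1$, any other job costs $k$. Let $C(t)$ be the running cost per job at time $t$, that is, the total cost of the $N_A(t)$ jobs that have arrived by time $t$ divided by $N_A(t)$, where a job costs $1$ if a spot instance has served it by time $t$ and $k$ otherwise ($C(t)=0$ if $N_A(t)=0$). Let $p_0^{(n)}$ be the probability that the $n$-th spot instance finds the queue empty on its arrival, and suppose that the system has a steady-state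 probability $\pi_0=\lim_{N\to\infty}\frac1N\sum_{n=1}^N p_0^{(n)}$ that the queue is empty when a spot instance arrives. Then, for any scheduling policy as above, $C(t)$ is integrable for every $t$, and the steady-state expected cost per job $\mathbb{E}[C]:=\lim_{t\to\infty}\mathbb{E}[C(t)]$ exists and equals $$\mathbb{E}[C] = k-(k-1)\,\frac{\mathbb{E}[A]}{\mathbb{E}[S_\mu]}\,(1-\pi_0).$$ -/

import Mathlib

open MeasureTheory ProbabilityTheory Filter Topology
open scoped ENNReal

noncomputable section

/-- A scheduling policy: a job that finds `n` jobs waiting joins the queue with probability `q n`.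
`X j n` is the maximal waiting time (possibly infinite) of job `j` if it joins after finding `n` jobs
waiting.  No assumption is made on the laws or the joint distribution of the waiting times; an i.i.d.
sequence indexed by the jobs, or laws that depend on the position in the queue, are special cases. -/
structure SchedulingPolicy (Ω : Type*) [MeasurableSpace Ω] where
  q : ℕ → ℝ
  q_mem : ∀ n, q n ∈ Set.Icc (0 : ℝ) 1
  X : ℕ → ℕ → Ω → ℝ≥0∞
  measurable_X : ∀ j n, Measurable (X j n)

/-- The data of the queueing system. Jobs and spot instances are numbered from `0`. -/
structure SpotSystem (Ω : Type*) [MeasurableSpace Ω] where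
  /-- job inter-arrival times -/
  A : ℕ → Ω → ℝ
  /-- spot inter-arrival times -/
  S : ℕ → Ω → ℝ
  /-- the coin of job `j`: having found `n` jobs waiting, it joins iff `U j < q n` -/
  U : ℕ → Ω → ℝ
  policy : SchedulingPolicy Ω

/-- `T` is a sequence of i.i.d. nonnegative inter-arrival times with finite positive mean. -/
structure IsRenewalSequence {Ω : Type*} [MeasurableSpace Ω] (T : ℕ → Ω → ℝ) (P : Measure Ω) :
    Prop where
  measurable : ∀ n, Measurable (T n)
  indep : iIndepFun T P
  ident : ∀ n, IdentDistrib (T n) (T 0) P P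
  nonneg : ∀ n, ∀ᵐ ω ∂P, 0 ≤ T n ω
  integrable : Integrable (T 0) P
  mean_pos : 0 < ∫ ω, T 0 ω ∂P

namespace SpotSystem

variable {Ω : Type*} [MeasurableSpace Ω]

/-- The probabilistic assumptions: jobs and spot instances arrive as two independent renewal
processes, and the joining coins are i.i.d. uniform on `[0, 1]`, independent of everything else. -/
structure IsGG1 (M : SpotSystem Ω) (P : Measure Ω) : Prop where
  renewal_A : IsRenewalSequence M.A P
  renewal_S : IsRenewalSequence M.S P
  indep_A_S : IndepFun (fun ω n => M.A n ω) (fun ω n => M.S n ω) P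
  measurable_U : ∀ j, Measurable (M.U j)
  uniform_U : ∀ j, P.map (M.U j) = volume.restrict (Set.Icc (0 : ℝ) 1)
  indep_U : iIndepFun M.U P
  indep_U_rest : IndepFun (fun ω j => M.U j ω)
    (fun ω => ((fun n => M.A n ω, fun n => M.S n ω, fun j n => M.policy.X j n ω) :
      (ℕ → ℝ) × (ℕ → ℝ) × (ℕ → ℕ → ℝ≥0∞))) P

variable (M : SpotSystem Ω)

/-- Arrival time of job `j`. -/
def jobTime (j : ℕ) (ω : Ω) : ℝ := ∑ i ∈ Finset.range (j + 1), M.A i ω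

/-- Arrival time of spot instance `n`. -/
def spotTime (n : ℕ) (ω : Ω) : ℝ := ∑ i ∈ Finset.range (n + 1), M.S i ω

/-- `N_A(t)`: the number of jobs that have arrived by time `t`. -/
def numJobs (t : ℝ) (ω : Ω) : ℕ := Set.ncard {j : ℕ | M.jobTime j ω ≤ t}

/-- A waiting job is recorded as `(j, n)`: its number `j`, and the number `n` of waiting jobs it found
when it arrived. It stays, unless served before, strictly before the time `deadline ω (j, n)`. -/
def deadline (ω : Ω) (e : ℕ × ℕ) : ℝ≥0∞ :=
  ENNReal.ofReal (M.jobTime e.1 ω) + M.policy.X e.1 e.2 ω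

/-- Remove from the queue the jobs whose maximal waiting time has expired at time `t`
(these are sent to an on-demand instance). -/
def expire (ω : Ω) (t : ℝ) (Q : List (ℕ × ℕ)) : List (ℕ × ℕ) :=
  Q.filter fun e => decide (ENNReal.ofReal t < M.deadline ω e)

/-- Arrival of job `j`: it finds the queue without the expired jobs, and either joins at the end,
or goes to an on-demand instance at once. -/
def jobArrives (ω : Ω) (Q : List (ℕ × ℕ)) (j : ℕ) : List (ℕ × ℕ) :=
  let Q' := M.expire ω (M.jobTime j ω) Q
  if M.U j ω < M.policy.q Q'.length then Q' ++ [(j, Q'.length)] else Q'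

/-- The number of jobs that arrive up to (and including) the arrival time of the last of the first
`n` spot instances; it is `0` for `n = 0`. -/
def jobsUpToSpot (ω : Ω) : ℕ → ℕ
  | 0 => 0
  | n + 1 => M.numJobs (M.spotTime n ω) ω

/-- The queue (first come, first served) found by spot instance `n` if its predecessor left the
queue `Q`: the jobs that arrived since then are handled one after the other, and expired jobs are
removed. -/
def evolve (ω : Ω) (n : ℕ) (Q : List (ℕ × ℕ)) : List (ℕ × ℕ) :=
  M.expire ω (M.spotTime n ω)
    ((List.Ico (M.jobsUpToSpot ω n) (M.jobsUpToSpot ω (n + 1))).foldl (M.jobArrives ω) Q)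

/-- The queue left behind by the first `n` spot instances: each one takes the first job of the queue
that it finds, if there is one. The queue is empty at time `0`. -/
def queueLeft (ω : Ω) : ℕ → List (ℕ × ℕ)
  | 0 => []
  | n + 1 => (M.evolve ω n (queueLeft ω n)).tail

/-- The queue found by spot instance `n` on its arrival. -/
def queueFound (ω : Ω) (n : ℕ) : List (ℕ × ℕ) := M.evolve ω n (M.queueLeft ω n)

/-- Spot instance `n` serves job `j`. -/
def Serves (ω : Ω) (n j : ℕ) : Prop := ((M.queueFound ω n).head?).map Prod.fst = some j

open Classical in
/-- Cost of job `j` as accounted at time `t`: `1` if a spot instance has served it by time `t`, and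
`k` otherwise. -/
def jobCost (k : ℝ) (t : ℝ) (ω : Ω) (j : ℕ) : ℝ :=
  if ∃ n, M.spotTime n ω ≤ t ∧ M.Serves ω n j then 1 else k

/-- Running cost per job `C(t)`: the average cost of the jobs that have arrived by time `t`
(with value `0` if there are none). -/
def runningCost (k : ℝ) (t : ℝ) (ω : Ω) : ℝ :=
  (∑ j ∈ Finset.range (M.numJobs t ω), M.jobCost k t ω j) / (M.numJobs t ω : ℝ)

/-- The probability that spot instance `n` finds the queue empty. -/
def emptyProb (P : Measure Ω) (n : ℕ) : ℝ := P.real {ω | M.queueFound ω n = []}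

/-- `π₀` is the steady-state probability (long-run average, over the spot instances, of the transient
probabilities) that the queue is empty when a spot instance arrives. -/
def IsSteadyStateEmptyProb (P : Measure Ω) (π₀ : ℝ) : Prop :=
  Tendsto (fun N : ℕ => (∑ n ∈ Finset.range N, M.emptyProb P n) / (N : ℝ)) atTop (𝓝 π₀)

end SpotSystem

end

/-! Let `D N` be the number of the first `N` spot instances that find a nonempty queue
(`numServing`). Each of them serves exactly one job, that job has already arrived, and no job is
served twice. Hence on every path with monotone unbounded arrival times the total cost at time `t`
is exactly `k * N_A(t) - (k - 1) * D (N_S(t))` (`RegularPath.sum_jobCost`); the policy enters only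
through `D`.

Nothing is known about the convergence of `D N / N` along a path: the hypothesis on `π₀` concerns
expectations at deterministic `N`, whereas `N_S(t)` is random. But `D` is 1-Lipschitz
(`abs_numServing_sub_le`) and `N_S(t) / t → 1 / E[S]` almost surely, so replacing `N_S(t)` by `⌊t /
E[S]⌋` costs only `o(t)`. Together with `N_A(t) / t → 1 / E[A]`, this puts the running cost almost
surely within `o(1)` of a function of `D m / m` with `m` deterministic
(`RegularPath.tendsto_runningCost_sub`). Everything is bounded, so dominated convergence carries
this over to expectations, where `E[D m] / m` is one minus the Cesàro mean of the `p_0^{(n)}`. -/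

/-! ### Renewal counting along a path. -/

/-- The number of points of the sequence `T` up to time `t`. -/
noncomputable def renewalCount (T : ℕ → ℝ) (t : ℝ) : ℕ := Set.ncard {n : ℕ | T n ≤ t}

theorem Monotone.setOf_le_eq_Iio_renewalCount {T : ℕ → ℝ} (hmono : Monotone T)
    (hT : Tendsto T atTop atTop) (t : ℝ) : {n : ℕ | T n ≤ t} = Set.Iio (renewalCount T t) := by
  obtain ⟨N, hN⟩ := (hT.eventually_gt_atTop t).exists
  have hex : ∃ n, t < T n := ⟨N, hN⟩
  have h : {n : ℕ | T n ≤ t} = Set.Iio (Nat.find hex) := by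
    ext n
    simp only [Set.mem_ofPred_eq, Set.mem_Iio, Nat.lt_find_iff, not_lt]
    exact ⟨fun h m hm => (hmono hm).trans h, fun h => h n le_rfl⟩
  have hc : renewalCount T t = Nat.find hex := by
    rw [renewalCount, h, ← Finset.coe_Iio, Set.ncard_coe_finset, Nat.card_Iio]
  rw [hc, h]

theorem Monotone.lt_renewalCount_iff {T : ℕ → ℝ} (hmono : Monotone T)
    (hT : Tendsto T atTop atTop) {t : ℝ} {n : ℕ} : n < renewalCount T t ↔ T n ≤ t :=
  (Set.ext_iff.1 (hmono.setOf_le_eq_Iio_renewalCount hT t) n).symm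

theorem tendsto_renewalCount_atTop {T : ℕ → ℝ} (hmono : Monotone T)
    (hT : Tendsto T atTop atTop) : Tendsto (renewalCount T) atTop atTop := by
  refine tendsto_atTop.2 fun n => ?_
  filter_upwards [eventually_ge_atTop (T n)] with t ht
  exact ((hmono.lt_renewalCount_iff hT).2 ht).le

/-- The elementary renewal theorem along a path that satisfies the law of large numbers. -/
theorem tendsto_renewalCount_div {x : ℕ → ℝ} {a : ℝ} (ha : 0 < a)
    (h : Tendsto (fun n : ℕ => (∑ i ∈ Finset.range n, x i) / n) atTop (𝓝 a))
    (hmono : Monotone fun n => ∑ i ∈ Finset.range (n + 1), x i)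
    (hT : Tendsto (fun n => ∑ i ∈ Finset.range (n + 1), x i) atTop atTop) :
    Tendsto (fun t : ℝ => (renewalCount (fun n => ∑ i ∈ Finset.range (n + 1), x i) t : ℝ) / t)
      atTop (𝓝 a⁻¹) := by
  set T : ℕ → ℝ := fun n => ∑ i ∈ Finset.range (n + 1), x i 
  have hN := tendsto_renewalCount_atTop hmono hT
  have hlow : Tendsto (fun t : ℝ => (∑ i ∈ Finset.range (renewalCount T t), x i) /
      (renewalCount T t : ℝ)) atTop (𝓝 a) := h.comp hN
  -- `T n` has `n + 1` terms, so with `N` the count, the last point before `t` is the sum of `N`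
  -- terms and the next one the sum of `N + 1`. The factor `1 + 1 / N` turns the denominator `N + 1`
  -- into `N`.
  have hup : Tendsto (fun t : ℝ => (∑ i ∈ Finset.range (renewalCount T t + 1), x i) /
      ((renewalCount T t + 1 : ℕ) : ℝ) * (1 + 1 / (renewalCount T t : ℝ))) atTop (𝓝 a) := by
    have h1 := h.comp ((tendsto_add_atTop_nat 1).comp hN)
    have h2 := (tendsto_one_div_atTop_nhds_zero_nat (𝕜 := ℝ)).comp hN
    simpa using h1.mul (h2.const_add 1)
  have hmid : Tendsto (fun t : ℝ => t / (renewalCount T t : ℝ)) atTop (𝓝 a) := by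
    refine tendsto_of_tendsto_of_tendsto_of_le_of_le' hlow hup ?_ ?_
    · filter_upwards [hN.eventually_gt_atTop 0] with t ht
      refine div_le_div_of_nonneg_right ?_ (Nat.cast_nonneg _)
      obtain ⟨m, hm⟩ := Nat.exists_eq_succ_of_ne_zero ht.ne'
      rw [hm]
      exact (hmono.lt_renewalCount_iff hT).1 (by rw [hm]; exact Nat.lt_succ_self m)
    · filter_upwards [hN.eventually_gt_atTop 0] with t ht
      have hpos : (0 : ℝ) < renewalCount T t := by exact_mod_cast ht
      have hlt : t ≤ T (renewalCount T t) := by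
        by_contra hcon
        exact lt_irrefl _ ((hmono.lt_renewalCount_iff hT).2 (not_le.1 hcon).le)
      have : (∑ i ∈ Finset.range (renewalCount T t + 1), x i) /
          ((renewalCount T t + 1 : ℕ) : ℝ) * (1 + 1 / (renewalCount T t : ℝ))
          = T (renewalCount T t) / (renewalCount T t : ℝ) := by
        change _ = (∑ i ∈ Finset.range (renewalCount T t + 1), x i) / (renewalCount T t : ℝ)
        generalize (∑ i ∈ Finset.range (renewalCount T t + 1), x i) = y
        push_cast
        field_simp
      rw [this]
      gcongr
  simpa [inv_div] using hmid.inv₀ ha.ne'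

namespace IsRenewalSequence

variable {Ω : Type*} [MeasurableSpace Ω] {P : Measure Ω} {T : ℕ → Ω → ℝ}

/-- Almost every path of a renewal process is monotone, unbounded, and has the renewal rate. -/
theorem ae_path (h : IsRenewalSequence T P) :
    ∀ᵐ ω ∂P, (Monotone fun n => ∑ i ∈ Finset.range (n + 1), T i ω) ∧
      Tendsto (fun n => ∑ i ∈ Finset.range (n + 1), T i ω) atTop atTop ∧
      Tendsto (fun t : ℝ => (renewalCount (fun n => ∑ i ∈ Finset.range (n + 1), T i ω) t : ℝ) / t)
        atTop (𝓝 (∫ ω, T 0 ω ∂P)⁻¹) := by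
  have hlln := ProbabilityTheory.strong_law_ae_real T h.integrable
    (fun i j hij => h.indep.indepFun hij) h.ident
  filter_upwards [hlln, ae_all_iff.2 h.nonneg] with ω hω hnn
  have hmono : Monotone fun n => ∑ i ∈ Finset.range (n + 1), T i ω := by
    refine monotone_nat_of_le_succ fun n => ?_
    rw [Finset.sum_range_succ _ (n + 1)]
    exact le_add_of_nonneg_right (hnn _)
  have hT : Tendsto (fun n => ∑ i ∈ Finset.range (n + 1), T i ω) atTop atTop := by
    have h1 : Tendsto (fun n : ℕ => ∑ i ∈ Finset.range n, T i ω) atTop atTop := by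
      refine (hω.pos_mul_atTop h.mean_pos tendsto_natCast_atTop_atTop).congr' ?_
      filter_upwards [eventually_gt_atTop 0] with n hn
      have : (n : ℝ) ≠ 0 := by positivity
      field_simp
    exact h1.comp (tendsto_add_atTop_nat 1)
  exact ⟨hmono, hT, tendsto_renewalCount_div h.mean_pos hω hmono hT⟩

end IsRenewalSequence

/-! ### First come, first served: order in the queue and uniqueness of service. -/

/-- The waiting jobs are in the order of their arrival, and have numbers in `[L, b)`. -/
def OrderedQueue (L b : ℕ) (Q : List (ℕ × ℕ)) : Prop :=
  L ≤ b ∧ Q.Pairwise (fun e f => e.1 < f.1) ∧ ∀ e ∈ Q, L ≤ e.1 ∧ e.1 < b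

theorem OrderedQueue.filter {L b : ℕ} {Q : List (ℕ × ℕ)} (h : OrderedQueue L b Q)
    (p : ℕ × ℕ → Bool) : OrderedQueue L b (Q.filter p) :=
  ⟨h.1, h.2.1.filter p, fun e he => h.2.2 e (List.mem_of_mem_filter he)⟩

theorem OrderedQueue.mono_right {L b b' : ℕ} {Q : List (ℕ × ℕ)} (h : OrderedQueue L b Q)
    (hb : b ≤ b') : OrderedQueue L b' Q :=
  ⟨h.1.trans hb, h.2.1, fun e he => ⟨(h.2.2 e he).1, (h.2.2 e he).2.trans_le hb⟩⟩

theorem OrderedQueue.append {L b n : ℕ} {Q : List (ℕ × ℕ)} (h : OrderedQueue L b Q) :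
    OrderedQueue L (b + 1) (Q ++ [(b, n)]) := by
  obtain ⟨h1, h2, h3⟩ := h
  refine ⟨by omega, List.pairwise_append.2 ⟨h2, List.pairwise_singleton _ _, ?_⟩, ?_⟩
  · intro e he f hf
    rw [List.mem_singleton.1 hf]
    exact (h3 e he).2
  · intro e he
    rcases List.mem_append.1 he with he | he
    · exact ⟨(h3 e he).1, by have := (h3 e he).2; omega⟩
    · rw [List.mem_singleton.1 he]
      exact ⟨h1, Nat.lt_succ_self b⟩

namespace SpotSystem

variable {Ω : Type*} [MeasurableSpace Ω] (M : SpotSystem Ω) {ω : Ω}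

theorem orderedQueue_jobArrives {L j : ℕ} {Q : List (ℕ × ℕ)} (h : OrderedQueue L j Q) :
    OrderedQueue L (j + 1) (M.jobArrives ω Q j) := by
  have h' : OrderedQueue L j (M.expire ω (M.jobTime j ω) Q) := h.filter _
  unfold jobArrives
  dsimp only
  split_ifs
  · exact h'.append
  · exact h'.mono_right (Nat.le_succ j)

theorem orderedQueue_foldl_jobArrives {L a b : ℕ} (hab : a ≤ b) {Q : List (ℕ × ℕ)}
    (h : OrderedQueue L a Q) : OrderedQueue L b ((List.Ico a b).foldl (M.jobArrives ω) Q) := by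
  induction b, hab using Nat.le_induction with
  | base => simpa using h
  | succ b hab ih =>
    rw [List.Ico.succ_top hab, List.foldl_append]
    exact M.orderedQueue_jobArrives ih

theorem numJobs_eq_renewalCount (t : ℝ) :
    M.numJobs t ω = renewalCount (fun j => M.jobTime j ω) t := rfl

/-- The number of spot instances that have arrived by time `t`. -/
noncomputable def numSpots (t : ℝ) (ω : Ω) : ℕ := renewalCount (fun n => M.spotTime n ω) t

/-- Both arrival sequences are monotone and unbounded along the path `ω`. -/
structure RegularPath (ω : Ω) : Prop where
  jobTime_mono : Monotone fun j => M.jobTime j ω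
  jobTime_tendsto : Tendsto (fun j => M.jobTime j ω) atTop atTop
  spotTime_mono : Monotone fun n => M.spotTime n ω
  spotTime_tendsto : Tendsto (fun n => M.spotTime n ω) atTop atTop

namespace RegularPath

variable {M}

theorem lt_numJobs_iff (h : M.RegularPath ω) {t : ℝ} {j : ℕ} :
    j < M.numJobs t ω ↔ M.jobTime j ω ≤ t :=
  h.jobTime_mono.lt_renewalCount_iff h.jobTime_tendsto

theorem lt_numSpots_iff (h : M.RegularPath ω) {t : ℝ} {n : ℕ} :
    n < M.numSpots t ω ↔ M.spotTime n ω ≤ t :=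
  h.spotTime_mono.lt_renewalCount_iff h.spotTime_tendsto

theorem numJobs_mono (h : M.RegularPath ω) : Monotone fun t => M.numJobs t ω := by
  intro s t hst
  by_contra hcon
  have := h.lt_numJobs_iff.1 (not_le.1 hcon)
  exact lt_irrefl _ (h.lt_numJobs_iff.2 (this.trans hst))

theorem jobsUpToSpot_mono (h : M.RegularPath ω) : Monotone (M.jobsUpToSpot ω) := by
  refine monotone_nat_of_le_succ fun n => ?_
  cases n with
  | zero => exact Nat.zero_le _
  | succ n => exact h.numJobs_mono (h.spotTime_mono (Nat.le_succ n))

theorem orderedQueue_evolve (h : M.RegularPath ω) {L n : ℕ} {Q : List (ℕ × ℕ)}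
    (hQ : OrderedQueue L (M.jobsUpToSpot ω n) Q) :
    OrderedQueue L (M.jobsUpToSpot ω (n + 1)) (M.evolve ω n Q) :=
  (M.orderedQueue_foldl_jobArrives (h.jobsUpToSpot_mono (Nat.le_succ n)) hQ).filter _

/-- The jobs served by the first `n` spot instances have smaller numbers than the jobs that wait. -/
theorem exists_orderedQueue_queueLeft (h : M.RegularPath ω) (n : ℕ) :
    ∃ L, OrderedQueue L (M.jobsUpToSpot ω n) (M.queueLeft ω n) ∧
      ∀ m < n, ∀ j, M.Serves ω m j → j < L := by
  induction n with
  | zero => exact ⟨0, ⟨le_rfl, by simp [queueLeft]⟩, by simp⟩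
  | succ n ih =>
    obtain ⟨L, hL, hS⟩ := ih
    have hF : OrderedQueue L (M.jobsUpToSpot ω (n + 1)) (M.queueFound ω n) :=
      h.orderedQueue_evolve hL
    change ∃ L, OrderedQueue L (M.jobsUpToSpot ω (n + 1)) (M.queueFound ω n).tail ∧ _
    cases hQ : M.queueFound ω n with
    | nil =>
      rw [hQ] at hF
      refine ⟨L, hF, fun m hm j hj => ?_⟩
      rcases Nat.lt_succ_iff_lt_or_eq.1 hm with hm | rfl
      · exact hS m hm j hj
      · simp [Serves, hQ] at hj
    | cons e Q =>
      rw [hQ] at hF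
      obtain ⟨h1, h2, h3⟩ := hF
      obtain ⟨hp, hp'⟩ := List.pairwise_cons.1 h2
      have he := h3 e List.mem_cons_self
      -- The served head `e` has the smallest number in the queue and a number at least `L`, so `e.1
      -- + 1` separates all served jobs from the remaining ones.
      refine ⟨e.1 + 1, ⟨he.2, hp', fun f hf =>
        ⟨hp f hf, (h3 f (List.mem_cons_of_mem _ hf)).2⟩⟩, fun m hm j hj => ?_⟩
      rcases Nat.lt_succ_iff_lt_or_eq.1 hm with hm | rfl
      · have := hS m hm j hj
        omega
      · simp only [Serves, hQ, List.head?_cons, Option.map_some, Option.some.injEq] at hj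
        omega

/-- The served job is in the queue found, so its number is at least the threshold `L` that exceeds
all jobs served earlier. The two conclusions make the map from serving spots to served jobs land
among arrived jobs and be injective. -/
theorem serves_bounds (h : M.RegularPath ω) {n j : ℕ} (hj : M.Serves ω n j) :
    j < M.jobsUpToSpot ω (n + 1) ∧ ∀ m < n, ¬ M.Serves ω m j := by
  obtain ⟨L, hL, hS⟩ := h.exists_orderedQueue_queueLeft n
  have hF : OrderedQueue L (M.jobsUpToSpot ω (n + 1)) (M.queueFound ω n) :=
    h.orderedQueue_evolve hL
  cases hQ : M.queueFound ω n with
  | nil => simp [Serves, hQ] at hj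
  | cons e Q =>
    rw [hQ] at hF
    simp only [Serves, hQ, List.head?_cons, Option.map_some, Option.some.injEq] at hj
    have he := hF.2.2 e List.mem_cons_self
    subst hj
    exact ⟨he.2, fun m hm hs => absurd (hS m hm _ hs) (not_lt.2 he.1)⟩

theorem serves_injective (h : M.RegularPath ω) {m n j : ℕ} (hm : M.Serves ω m j)
    (hn : M.Serves ω n j) : m = n := by
  rcases lt_trichotomy m n with hlt | heq | hlt
  · exact absurd hm ((h.serves_bounds hn).2 m hlt)
  · exact heq
  · exact absurd hn ((h.serves_bounds hm).2 n hlt)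

end RegularPath

/-! ### Pathwise cost accounting. -/

theorem exists_serves_iff {n : ℕ} : (∃ j, M.Serves ω n j) ↔ M.queueFound ω n ≠ [] := by
  unfold Serves
  cases M.queueFound ω n <;> simp

open Classical in
/-- The number of the first `N` spot instances that serve a job. -/
noncomputable def numServing (N : ℕ) (ω : Ω) : ℕ :=
  ((Finset.range N).filter fun n => M.queueFound ω n ≠ []).card

-- Sending a serving spot instance to its job is a bijection: a spot serves only the head of its
-- queue, and no head is served twice.
open Classical in
theorem RegularPath.card_served {M : SpotSystem Ω} (h : M.RegularPath ω) (t : ℝ) :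
    ((Finset.range (M.numJobs t ω)).filter
      fun j => ∃ n, M.spotTime n ω ≤ t ∧ M.Serves ω n j).card =
      M.numServing (M.numSpots t ω) ω := by
  symm
  have hex : ∀ n ∈ (Finset.range (M.numSpots t ω)).filter fun n => M.queueFound ω n ≠ [],
      ∃ j, M.Serves ω n j := fun n hn => M.exists_serves_iff.2 (Finset.mem_filter.1 hn).2
  refine Finset.card_bij (fun n hn => (hex n hn).choose) ?_ ?_ ?_
  · intro n hn
    have hs := (hex n hn).choose_spec
    have hn' := h.lt_numSpots_iff.1 (Finset.mem_range.1 (Finset.mem_filter.1 hn).1)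
    refine Finset.mem_filter.2 ⟨Finset.mem_range.2 ?_, n, hn', hs⟩
    exact (h.serves_bounds hs).1.trans_le (h.numJobs_mono hn')
  · intro n hn m hm heq
    have hs := (hex n hn).choose_spec
    rw [heq] at hs
    exact h.serves_injective hs (hex m hm).choose_spec
  · intro j hj
    obtain ⟨-, n, hn, hs⟩ := Finset.mem_filter.1 hj
    have hmem : n ∈ (Finset.range (M.numSpots t ω)).filter fun n => M.queueFound ω n ≠ [] :=
      Finset.mem_filter.2 ⟨Finset.mem_range.2 (h.lt_numSpots_iff.2 hn),
        M.exists_serves_iff.1 ⟨j, hs⟩⟩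
    refine ⟨n, hmem, ?_⟩
    have hs' := (hex n hmem).choose_spec
    unfold Serves at hs hs'
    exact Option.some.inj (hs'.symm.trans hs)

theorem RegularPath.sum_jobCost {M : SpotSystem Ω} (h : M.RegularPath ω) (k t : ℝ) :
    ∑ j ∈ Finset.range (M.numJobs t ω), M.jobCost k t ω j =
      k * M.numJobs t ω - (k - 1) * M.numServing (M.numSpots t ω) ω := by
  classical
  have hcost : ∀ j, M.jobCost k t ω j =
      k - (k - 1) * (if ∃ n, M.spotTime n ω ≤ t ∧ M.Serves ω n j then 1 else 0) := by
    intro j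
    unfold jobCost
    split_ifs <;> ring
  simp_rw [hcost]
  rw [Finset.sum_sub_distrib, ← Finset.mul_sum, Finset.sum_boole, h.card_served]
  simp [mul_comm]

theorem numServing_le (N : ℕ) : M.numServing N ω ≤ N := by
  classical
  exact (Finset.card_filter_le _ _).trans_eq (Finset.card_range N)

theorem numServing_succ_bounds (N : ℕ) : M.numServing N ω ≤ M.numServing (N + 1) ω ∧
    M.numServing (N + 1) ω ≤ M.numServing N ω + 1 := by
  classical
  unfold numServing
  rw [Finset.range_add_one, Finset.filter_insert]
  split_ifs
  · rw [Finset.card_insert_of_notMem (by simp)]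
    omega
  · omega

/-- One more spot instance serves at most one more job. This is what permits exchanging a random
number of spots for a deterministic one. -/
theorem abs_numServing_sub_le (m n : ℕ) :
    |(M.numServing m ω : ℝ) - M.numServing n ω| ≤ |(m : ℝ) - n| := by
  have key : ∀ a d : ℕ, M.numServing a ω ≤ M.numServing (a + d) ω ∧
      M.numServing (a + d) ω ≤ M.numServing a ω + d := by
    intro a d
    induction d with
    | zero => simp
    | succ d ih =>
      have := M.numServing_succ_bounds (ω := ω) (a + d)
      rw [← add_assoc]
      omega
  rcases le_total m n with h | h <;> obtain ⟨d, rfl⟩ := Nat.exists_eq_add_of_le h <;>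
    obtain ⟨h1, h2⟩ := key _ d
  · rw [abs_sub_comm, abs_sub_comm (m : ℝ)]
    have h1' : (M.numServing m ω : ℝ) ≤ M.numServing (m + d) ω := by exact_mod_cast h1
    have h2' : (M.numServing (m + d) ω : ℝ) ≤ M.numServing m ω + d := by exact_mod_cast h2
    push_cast
    rw [abs_of_nonneg (by linarith), abs_of_nonneg (by simp)]
    linarith
  · have h1' : (M.numServing n ω : ℝ) ≤ M.numServing (n + d) ω := by exact_mod_cast h1
    have h2' : (M.numServing (n + d) ω : ℝ) ≤ M.numServing n ω + d := by exact_mod_cast h2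
    push_cast
    rw [abs_of_nonneg (by linarith), abs_of_nonneg (by simp)]
    linarith

/-- Valid for every `ω`, regular or not; it gives both integrability and the dominating constant. -/
theorem abs_runningCost_le (k t : ℝ) : |M.runningCost k t ω| ≤ 1 + |k| := by
  have hcost : ∀ j, |M.jobCost k t ω j| ≤ 1 + |k| := by
    intro j
    unfold jobCost
    split_ifs
    · simp
    · linarith
  unfold runningCost
  rw [abs_div, Nat.abs_cast]
  refine div_le_of_le_mul₀ (Nat.cast_nonneg _) (by positivity) ?_
  calc |∑ j ∈ Finset.range (M.numJobs t ω), M.jobCost k t ω j|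
      ≤ ∑ j ∈ Finset.range (M.numJobs t ω), |M.jobCost k t ω j| := Finset.abs_sum_le_sum_abs _ _
    _ ≤ ∑ _j ∈ Finset.range (M.numJobs t ω), (1 + |k|) := Finset.sum_le_sum fun j _ => hcost j
    _ = (1 + |k|) * M.numJobs t ω := by
      rw [Finset.sum_const, Finset.card_range, nsmul_eq_mul, mul_comm]

end SpotSystem

/-! ### Measurability and expectations. -/

theorem measurable_ncard_setOf {α : Type*} [MeasurableSpace α] {p : ℕ → α → Prop}
    (hp : ∀ n, MeasurableSet {x | p n x}) : Measurable fun x => Set.ncard {n | p n x} := by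
  have hF : ∀ F : Finset ℕ, MeasurableSet {x | {n | p n x} = (F : Set ℕ)} := by
    intro F
    have : {x | {n | p n x} = (F : Set ℕ)} = ⋂ n, {x | p n x ↔ n ∈ F} := by
      ext x
      simp [Set.ext_iff]
    rw [this]
    exact MeasurableSet.iInter fun n => (hp n).iff (MeasurableSet.const _)
  have hfin : ∀ m : ℕ, MeasurableSet
      {x | ∃ F : Finset ℕ, F.card = m ∧ {n | p n x} = (F : Set ℕ)} := by
    intro m
    rw [Set.ofPred_exists]
    exact MeasurableSet.iUnion fun F => (MeasurableSet.const _).inter (hF F)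
  have hinf : MeasurableSet {x | ¬ ∃ F : Finset ℕ, {n | p n x} = (F : Set ℕ)} := by
    have : MeasurableSet {x | ∃ F : Finset ℕ, {n | p n x} = (F : Set ℕ)} := by
      rw [Set.ofPred_exists]
      exact MeasurableSet.iUnion hF
    exact this.compl
  refine measurable_to_countable' fun m => ?_
  -- Infinite sets have `ncard` equal to `0`, hence the extra piece of the fibre over `m = 0`.
  have : (fun x => Set.ncard {n | p n x}) ⁻¹' {m} =
      {x | ∃ F : Finset ℕ, F.card = m ∧ {n | p n x} = (F : Set ℕ)} ∪
        ({x | ¬ ∃ F : Finset ℕ, {n | p n x} = (F : Set ℕ)} ∩ {_x | m = 0}) := by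
    ext x
    simp only [Set.mem_preimage, Set.mem_singleton_iff, Set.mem_union, Set.mem_inter_iff,
      Set.mem_ofPred_eq]
    by_cases h : {n | p n x}.Finite
    · have h1 : {n | p n x} = ((h.toFinset : Finset ℕ) : Set ℕ) := h.coe_toFinset.symm
      have h2 : {n | p n x}.ncard = h.toFinset.card := Set.ncard_eq_toFinset_card _ h
      constructor
      · intro hm
        exact Or.inl ⟨h.toFinset, h2 ▸ hm, h1⟩
      · rintro (⟨F, hc, hF'⟩ | ⟨hn, -⟩)
        · rw [hF', Set.ncard_coe_finset, hc]
        · exact absurd ⟨_, h1⟩ hn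
    · rw [Set.Infinite.ncard h]
      have hn : ¬ ∃ F : Finset ℕ, {n | p n x} = (F : Set ℕ) := by
        rintro ⟨F, hF'⟩
        exact h (hF' ▸ F.finite_toSet)
      constructor
      · intro hm
        exact Or.inr ⟨hn, hm.symm⟩
      · rintro (⟨F, -, hF'⟩ | ⟨-, hm⟩)
        · exact absurd ⟨F, hF'⟩ hn
        · exact hm.symm
  rw [this]
  exact (hfin m).union (hinf.inter (MeasurableSet.const _))

/-- A function of a countably valued measurable argument and of a further parameter is measurable
if it is so for each value of the argument. -/
theorem Measurable.of_countable_arg {α β γ : Type*} [MeasurableSpace α] [MeasurableSpace β]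
    [MeasurableSpace γ] [Countable β] [MeasurableSingletonClass β] {f : α → β → γ} {g : α → β}
    (hf : ∀ b, Measurable fun x => f x b) (hg : Measurable g) :
    Measurable fun x => f x (g x) :=
  (measurable_from_prod_countable_left (f := fun z : α × β => f z.1 z.2) hf).comp
    (measurable_id.prodMk hg)

namespace SpotSystem

variable {Ω : Type*} [MeasurableSpace Ω] {M : SpotSystem Ω} {P : Measure Ω}

-- Queues range over a countable type. With the discrete σ-algebra, measurability of the queue
-- recursion can be checked with the current queue frozen, by `Measurable.of_countable_arg`.
local instance : MeasurableSpace (List (ℕ × ℕ)) := ⊤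

local instance : DiscreteMeasurableSpace (List (ℕ × ℕ)) := ⟨fun _ => trivial⟩

namespace IsGG1

theorem measurable_jobTime (h : M.IsGG1 P) (j : ℕ) : Measurable (M.jobTime j) :=
  Finset.measurable_sum _ fun i _ => h.renewal_A.measurable i

theorem measurable_spotTime (h : M.IsGG1 P) (n : ℕ) : Measurable (M.spotTime n) :=
  Finset.measurable_sum _ fun i _ => h.renewal_S.measurable i

theorem measurable_numJobs (h : M.IsGG1 P) {τ : Ω → ℝ} (hτ : Measurable τ) :
    Measurable fun ω => M.numJobs (τ ω) ω :=
  measurable_ncard_setOf fun j => measurableSet_le (h.measurable_jobTime j) hτ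

theorem measurable_deadline (h : M.IsGG1 P) (e : ℕ × ℕ) : Measurable fun ω => M.deadline ω e :=
  (h.measurable_jobTime e.1).ennreal_ofReal.add (M.policy.measurable_X e.1 e.2)

theorem measurable_expire (h : M.IsGG1 P) {τ : Ω → ℝ} (hτ : Measurable τ) (Q : List (ℕ × ℕ)) :
    Measurable fun ω => M.expire ω (τ ω) Q := by
  induction Q with
  | nil => exact measurable_const
  | cons e Q ih =>
    have : (fun ω => M.expire ω (τ ω) (e :: Q)) = fun ω =>
        if ENNReal.ofReal (τ ω) < M.deadline ω e then e :: M.expire ω (τ ω) Q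
        else M.expire ω (τ ω) Q := by
      funext ω
      simp only [expire, List.filter_cons, decide_eq_true_eq]
    rw [this]
    exact Measurable.ite (measurableSet_lt hτ.ennreal_ofReal (h.measurable_deadline e))
      ((measurable_of_countable (List.cons e)).comp ih) ih

theorem measurable_jobArrives (h : M.IsGG1 P) (Q : List (ℕ × ℕ)) (j : ℕ) :
    Measurable fun ω => M.jobArrives ω Q j := by
  refine Measurable.of_countable_arg
    (f := fun ω Q' => if M.U j ω < M.policy.q Q'.length then Q' ++ [(j, Q'.length)] else Q')
    (fun Q' => ?_) (h.measurable_expire (h.measurable_jobTime j) Q)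
  exact Measurable.ite (measurableSet_lt (h.measurable_U j) measurable_const)
    measurable_const measurable_const

theorem measurable_foldl_jobArrives (h : M.IsGG1 P) (l : List ℕ) {Q : Ω → List (ℕ × ℕ)}
    (hQ : Measurable Q) : Measurable fun ω => l.foldl (M.jobArrives ω) (Q ω) := by
  induction l generalizing Q with
  | nil => exact hQ
  | cons j l ih =>
    simp only [List.foldl_cons]
    exact ih (Measurable.of_countable_arg (f := fun ω Q' => M.jobArrives ω Q' j)
      (fun Q' => h.measurable_jobArrives Q' j) hQ)

theorem measurable_jobsUpToSpot (h : M.IsGG1 P) (n : ℕ) :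
    Measurable fun ω => M.jobsUpToSpot ω n := by
  cases n with
  | zero => exact measurable_const
  | succ n => exact h.measurable_numJobs (h.measurable_spotTime n)

theorem measurable_evolve (h : M.IsGG1 P) (n : ℕ) {Q : Ω → List (ℕ × ℕ)} (hQ : Measurable Q) :
    Measurable fun ω => M.evolve ω n (Q ω) := by
  refine Measurable.of_countable_arg (f := fun ω Q' => M.expire ω (M.spotTime n ω) Q')
    (h.measurable_expire (h.measurable_spotTime n)) ?_
  -- The range of the fold is random; its pair of endpoints takes countably many values.
  refine Measurable.of_countable_arg
    (f := fun ω (ab : ℕ × ℕ) => (List.Ico ab.1 ab.2).foldl (M.jobArrives ω) (Q ω))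
    (fun ab => h.measurable_foldl_jobArrives _ hQ)
    ((h.measurable_jobsUpToSpot n).prodMk (h.measurable_jobsUpToSpot (n + 1)))

theorem measurable_queueLeft (h : M.IsGG1 P) (n : ℕ) : Measurable fun ω => M.queueLeft ω n := by
  induction n with
  | zero => exact measurable_const
  | succ n ih => exact (measurable_of_countable List.tail).comp (h.measurable_evolve n ih)

theorem measurable_queueFound (h : M.IsGG1 P) (n : ℕ) : Measurable fun ω => M.queueFound ω n :=
  h.measurable_evolve n (h.measurable_queueLeft n)

theorem measurableSet_queueFound_mem (h : M.IsGG1 P) (n : ℕ) (s : Set (List (ℕ × ℕ))) :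
    MeasurableSet {ω | M.queueFound ω n ∈ s} :=
  h.measurable_queueFound n (MeasurableSet.of_discrete (s := s))

theorem measurable_jobCost (h : M.IsGG1 P) (k t : ℝ) (j : ℕ) :
    Measurable fun ω => M.jobCost k t ω j := by
  refine Measurable.ite ?_ measurable_const measurable_const
  rw [Set.ofPred_exists]
  exact MeasurableSet.iUnion fun n =>
    (measurableSet_le (h.measurable_spotTime n) measurable_const).inter
      (h.measurableSet_queueFound_mem n {Q | Q.head?.map Prod.fst = some j})

theorem measurable_runningCost (h : M.IsGG1 P) (k t : ℝ) : Measurable (M.runningCost k t) :=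
  Measurable.of_countable_arg
    (f := fun ω (N : ℕ) => (∑ j ∈ Finset.range N, M.jobCost k t ω j) / (N : ℝ))
    (fun _ => (Finset.measurable_sum _ fun j _ => h.measurable_jobCost k t j).div_const _)
    (h.measurable_numJobs measurable_const)

theorem integrable_runningCost [IsFiniteMeasure P] (h : M.IsGG1 P) (k t : ℝ) :
    Integrable (M.runningCost k t) P :=
  Integrable.of_bound (h.measurable_runningCost k t).aestronglyMeasurable (1 + |k|)
    (ae_of_all _ fun _ => M.abs_runningCost_le k t)

theorem numServing_eq_sum (N : ℕ) (ω : Ω) : (M.numServing N ω : ℝ) =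
    ∑ n ∈ Finset.range N, ({ω | M.queueFound ω n = []}ᶜ).indicator (fun _ => (1 : ℝ)) ω := by
  classical
  rw [numServing, ← Finset.sum_boole]
  refine Finset.sum_congr rfl fun n _ => ?_
  by_cases hn : M.queueFound ω n = [] <;> simp [hn]

theorem measurable_numServing (h : M.IsGG1 P) (N : ℕ) :
    Measurable fun ω => (M.numServing N ω : ℝ) := by
  simp_rw [numServing_eq_sum]
  exact Finset.measurable_sum _ fun n _ =>
    measurable_const.indicator (h.measurableSet_queueFound_mem n {[]}).compl

theorem integral_numServing [IsProbabilityMeasure P] (h : M.IsGG1 P) (N : ℕ) :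
    ∫ ω, (M.numServing N ω : ℝ) ∂P = N - ∑ n ∈ Finset.range N, M.emptyProb P n := by
  have hs : ∀ n, MeasurableSet {ω | M.queueFound ω n = []} :=
    fun n => h.measurableSet_queueFound_mem n {[]}
  simp_rw [numServing_eq_sum]
  rw [integral_finsetSum _ fun n _ => (integrable_const _).indicator (hs n).compl]
  have : ∀ n, ∫ ω, ({ω | M.queueFound ω n = []}ᶜ).indicator (fun _ => (1 : ℝ)) ω ∂P =
      1 - M.emptyProb P n := by
    intro n
    rw [integral_indicator_const _ (hs n).compl, probReal_compl_eq_one_sub (hs n)]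
    simp [emptyProb]
  simp [this]

theorem ae_regularPath (h : M.IsGG1 P) : ∀ᵐ ω ∂P, M.RegularPath ω ∧
    Tendsto (fun t : ℝ => (M.numJobs t ω : ℝ) / t) atTop (𝓝 (∫ ω, M.A 0 ω ∂P)⁻¹) ∧
    Tendsto (fun t : ℝ => (M.numSpots t ω : ℝ) / t) atTop (𝓝 (∫ ω, M.S 0 ω ∂P)⁻¹) := by
  filter_upwards [h.renewal_A.ae_path, h.renewal_S.ae_path] with ω hA hS
  exact ⟨⟨hA.1, hA.2.1, hS.1, hS.2.1⟩, hA.2.2, hS.2.2⟩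

end IsGG1

/-! ### Pathwise asymptotics and passage to expectations. -/

/-- The cost per job along a path, compared with the fraction of serving spot instances among a
deterministic number of them. -/
theorem RegularPath.tendsto_runningCost_sub {ω : Ω} (h : M.RegularPath ω) {a s : ℝ} (ha : 0 < a)
    (hs : 0 < s) (hA : Tendsto (fun t : ℝ => (M.numJobs t ω : ℝ) / t) atTop (𝓝 a⁻¹))
    (hS : Tendsto (fun t : ℝ => (M.numSpots t ω : ℝ) / t) atTop (𝓝 s⁻¹)) (k : ℝ) :
    Tendsto (fun t : ℝ => M.runningCost k t ω -
      (k - (k - 1) * (a / s) * ((M.numServing ⌊s⁻¹ * t⌋₊ ω : ℝ) / (⌊s⁻¹ * t⌋₊ : ℝ))))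
      atTop (𝓝 0) := by
  have hm : Tendsto (fun t : ℝ => (⌊s⁻¹ * t⌋₊ : ℝ) / t) atTop (𝓝 s⁻¹) :=
    tendsto_nat_floor_mul_div_atTop (inv_nonneg.2 hs.le)
  have hA' : Tendsto (fun t : ℝ => t / (M.numJobs t ω : ℝ)) atTop (𝓝 a) := by
    simpa [inv_div] using hA.inv₀ (inv_ne_zero ha.ne')
  have hdiff : Tendsto (fun t : ℝ => (M.numServing (M.numSpots t ω) ω : ℝ) / t -
      (M.numServing ⌊s⁻¹ * t⌋₊ ω : ℝ) / t) atTop (𝓝 0) := by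
    have h0 : Tendsto (fun t : ℝ => |(M.numSpots t ω : ℝ) / t - (⌊s⁻¹ * t⌋₊ : ℝ) / t|)
        atTop (𝓝 0) := by
      simpa using (hS.sub hm).abs
    refine squeeze_zero_norm (fun t => ?_) h0
    rw [Real.norm_eq_abs, ← sub_div, ← sub_div, abs_div, abs_div]
    exact div_le_div_of_nonneg_right (M.abs_numServing_sub_le _ _) (abs_nonneg _)
  have hfirst := hdiff.mul hA'
  -- The fraction of serving spots need not converge along the path; it is only bounded by `1`, so
  -- the other factor must vanish.
  have hsecond : Tendsto (fun t : ℝ =>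
      ((M.numServing ⌊s⁻¹ * t⌋₊ ω : ℝ) / (⌊s⁻¹ * t⌋₊ : ℝ)) *
        ((⌊s⁻¹ * t⌋₊ : ℝ) / t * (t / (M.numJobs t ω : ℝ)) - a / s)) atTop (𝓝 0) := by
    have h0 : Tendsto (fun t : ℝ => |(⌊s⁻¹ * t⌋₊ : ℝ) / t * (t / (M.numJobs t ω : ℝ)) - a / s|)
        atTop (𝓝 0) := by
      have := ((hm.mul hA').sub_const (a / s)).abs
      rwa [show s⁻¹ * a - a / s = 0 by ring, abs_zero] at this
    refine squeeze_zero_norm (fun t => ?_) h0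
    rw [Real.norm_eq_abs, abs_mul]
    refine mul_le_of_le_one_left (abs_nonneg _) ?_
    rw [abs_of_nonneg (by positivity)]
    exact div_le_one_of_le₀ (by exact_mod_cast M.numServing_le _) (Nat.cast_nonneg _)
  -- Once `t`, `N_A(t)` and the floor are nonzero, this combination is exactly the difference in the
  -- goal.
  have hsum := (hfirst.add hsecond).const_mul (-(k - 1))
  rw [zero_mul, add_zero, mul_zero] at hsum
  refine hsum.congr' ?_
  have hNA := tendsto_renewalCount_atTop h.jobTime_mono h.jobTime_tendsto
  have hfl : Tendsto (fun t : ℝ => ⌊s⁻¹ * t⌋₊) atTop atTop :=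
    tendsto_nat_floor_atTop.comp (tendsto_id.const_mul_atTop (inv_pos.2 hs))
  filter_upwards [eventually_gt_atTop 0, hNA.eventually_gt_atTop 0,
    hfl.eventually_gt_atTop 0] with t ht hN hfl
  rw [← M.numJobs_eq_renewalCount] at hN
  have hN' : (M.numJobs t ω : ℝ) ≠ 0 := by positivity
  have hfl' : (⌊s⁻¹ * t⌋₊ : ℝ) ≠ 0 := by positivity
  rw [runningCost, h.sum_jobCost]
  generalize ⌊s⁻¹ * t⌋₊ = m at hfl'
  field_simp
  ring

end SpotSystem

theorem theorem1 {Ω : Type*} [MeasurableSpace Ω] (P : Measure Ω) [IsProbabilityMeasure P]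
    (M : SpotSystem Ω) (hM : M.IsGG1 P) (k π₀ : ℝ) (hπ₀ : M.IsSteadyStateEmptyProb P π₀) :
    (∀ t : ℝ, Integrable (M.runningCost k t) P) ∧
    Tendsto (fun t : ℝ => ∫ ω, M.runningCost k t ω ∂P) atTop
      (𝓝 (k - (k - 1) * ((∫ ω, M.A 0 ω ∂P) / (∫ ω, M.S 0 ω ∂P)) * (1 - π₀))) := by
  refine ⟨hM.integrable_runningCost k, ?_⟩
  set a := ∫ ω, M.A 0 ω ∂P with ha_def
  set s := ∫ ω, M.S 0 ω ∂P with hs_def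
  have ha : 0 < a := hM.renewal_A.mean_pos
  have hs : 0 < s := hM.renewal_S.mean_pos
  have hfrac : ∀ (N : ℕ) (ω : Ω), |(M.numServing N ω : ℝ) / (N : ℝ)| ≤ 1 := fun N ω => by
    rw [abs_of_nonneg (by positivity)]
    exact div_le_one_of_le₀ (by exact_mod_cast M.numServing_le _) (Nat.cast_nonneg _)
  -- Surrogate for the running cost: its only randomness is `numServing` at a deterministic index,
  -- so its mean is explicit in the `emptyProb`.
  let g : ℝ → Ω → ℝ := fun t ω =>
    k - (k - 1) * (a / s) * ((M.numServing ⌊s⁻¹ * t⌋₊ ω : ℝ) / (⌊s⁻¹ * t⌋₊ : ℝ))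
  have hint : ∀ N : ℕ, Integrable (fun ω => (M.numServing N ω : ℝ) / (N : ℝ)) P := fun N =>
    Integrable.of_bound ((hM.measurable_numServing N).div_const _).aestronglyMeasurable 1
      (ae_of_all _ (hfrac N))
  have hgint : ∀ t, Integrable (g t) P := fun t =>
    (integrable_const k).sub ((hint _).const_mul _)
  have hdiff : Tendsto (fun t : ℝ => ∫ ω, (M.runningCost k t ω - g t ω) ∂P) atTop (𝓝 0) := by
    have := MeasureTheory.tendsto_integral_filter_of_dominated_convergence (μ := P)
      (l := (atTop : Filter ℝ)) (F := fun t ω => M.runningCost k t ω - g t ω)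
      (f := fun _ => (0 : ℝ)) (fun _ => (1 + |k|) + (|k| + |(k - 1) * (a / s)|))
      (Eventually.of_forall fun t =>
        ((hM.integrable_runningCost k t).sub (hgint t)).aestronglyMeasurable)
      (Eventually.of_forall fun t => ae_of_all _ fun ω => ?_) (integrable_const _) ?_
    · simpa using this
    · refine (norm_sub_le _ _).trans (add_le_add (M.abs_runningCost_le k t) ?_)
      refine (norm_sub_le _ _).trans (add_le_add le_rfl ?_)
      rw [Real.norm_eq_abs, abs_mul]
      exact mul_le_of_le_one_right (abs_nonneg _) (hfrac _ ω)
    · filter_upwards [hM.ae_regularPath] with ω hω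
      exact hω.1.tendsto_runningCost_sub ha hs hω.2.1 hω.2.2 k
  have hfl : Tendsto (fun t : ℝ => ⌊s⁻¹ * t⌋₊) atTop atTop :=
    tendsto_nat_floor_atTop.comp (tendsto_id.const_mul_atTop (inv_pos.2 hs))
  have hfrac_lim : Tendsto (fun N : ℕ => ∫ ω, (M.numServing N ω : ℝ) / (N : ℝ) ∂P) atTop
      (𝓝 (1 - π₀)) := by
    refine (hπ₀.const_sub 1).congr' ?_
    filter_upwards [eventually_gt_atTop 0] with N hN
    have : (N : ℝ) ≠ 0 := by positivity
    rw [integral_div, hM.integral_numServing, sub_div, div_self this]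
  have hg : Tendsto (fun t : ℝ => ∫ ω, g t ω ∂P) atTop
      (𝓝 (k - (k - 1) * (a / s) * (1 - π₀))) := by
    refine (((hfrac_lim.comp hfl).const_mul ((k - 1) * (a / s))).const_sub k).congr fun t => ?_
    rw [integral_sub (integrable_const k) ((hint _).const_mul _), integral_const_mul]
    simp
  have hsum := hdiff.add hg
  rw [zero_add] at hsum
  refine hsum.congr fun t => ?_
  rw [integral_sub (hM.integrable_runningCost k t) (hgint t)]
  ring
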